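/- Fix integers $e\ge 2$ and $m$. A partition is a non-increasing sequence $\lambda_0\ge\lambda_1\ge\cdots$ of non-negative integers with finitely many nonzero terms; it is $e$-restricted if $\lambda_i-\lambda_{i+1}<e$ for all $i\ge0$. Its set of beta numbers of charge $m$ is $J=\{j_k\mid k\ge 0\}\subset\mathbb Z$, $j_k=\lambda_k+m-k$. For a set of beta numbers $J$ put $U(J)=\{x\in J\mid x-e\notin J\}$. If $U(J)=\emptyset$, let $\operatorname{down}(J)=J$. Otherwise put $p'=\min U(J)$, $q'=\min\bigl(\{x>p'-e\mid x\in J,\ x+e\notin J\}\cup\{p'\}\bigr)$ and $\operatorname{down}(J)=(J\setminus\{q'\})\cup\{p'-e\}$. Let $\operatorname{base}(J)$ be the set obtained by applying $\operatorname{down}$ repeatedly to $J$ until $U=\emptyset$. For $x\in\mathbb Z$ write $J_{\le x}=J\cap\mathbb Z_{\le x}$. Proposition. Let $\lambda$ be an $e$-restricted partition, $J$ its set of beta numbers of charge $m$, $j_0=\max J$, and $K=J_{\le j_0-1}$. Then the processes defining $\operatorname{base}(J)$ and $\operatorname{base}(K)$ stop after finitely many steps, $\operatorname{base}(K)\cup\{j_0\}$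 is the set of beta numbers of charge $m$ of an $e$-restricted partition, and $$\operatorname{base}(J)=\operatorname{base}(\operatorname{base}(K)\cup\{j_0\}).$$ Consequently $\operatorname{base}(J)$ can be computed row by row: for every $r\ge0$, if $J_{r+1}=J_{\le j_r-1}$ and $J_k=\operatorname{base}(J_{k+1})\cup\{j_k\}$ for $k=r,r-1,\dots,0$, then each $J_k$ $(0\le k\le r)$ is the set of beta numbers of charge $m-k$ of an $e$-restricted partition, and $\operatorname{base}(J)=\operatorname{base}(J_0)$. -/

import Mathlib

/-- A partition: a non-increasing sequence `l 0 ≥ l 1 ≥ ⋯` of non-negative integers with only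
finitely many nonzero terms. -/
def IsPartition (l : ℕ → ℕ) : Prop :=
  Antitone l ∧ (Function.support l).Finite

/-- `l` is `e`-restricted: every difference `l i - l (i + 1)` is smaller than `e`. -/
def IsRestricted (e : ℕ) (l : ℕ → ℕ) : Prop :=
  ∀ i, l i < l (i + 1) + e

/-- The `k`-th beta number of charge `m` of `l`. -/
def betaNumber (m : ℤ) (l : ℕ → ℕ) (k : ℕ) : ℤ :=
  (l k : ℤ) + m - (k : ℤ)

/-- The set of beta numbers of charge `m` of `l`. -/
def betaSet (m : ℤ) (l : ℕ → ℕ) : Set ℤ :=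
  Set.range (betaNumber m l)

/-- `J` is the set of beta numbers of charge `m` of some `e`-restricted partition. -/
def IsRestrictedBetaSet (e : ℕ) (m : ℤ) (J : Set ℤ) : Prop :=
  ∃ l : ℕ → ℕ, IsPartition l ∧ IsRestricted e l ∧ betaSet m l = J

/-- The beads of `J` which can be slid up by one in their runner of the `e`-abacus. -/
def slidable (e : ℕ) (J : Set ℤ) : Set ℤ :=
  {x | x ∈ J ∧ x - (e : ℤ) ∉ J}

/-- The set `{x > p' - e ∣ x ∈ J, x + e ∉ J} ∪ {p'}`, where `p' = min (slidable e J)`. -/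
noncomputable def downCandidates (e : ℕ) (J : Set ℤ) : Set ℤ :=
  {x | sInf (slidable e J) - (e : ℤ) < x ∧ x ∈ J ∧ x + (e : ℤ) ∉ J} ∪ {sInf (slidable e J)}

open Classical in
/-- The down operation: if some bead can be slid up, move the bead `q' = min (downCandidates e J)`
to `p' - e`, where `p' = min (slidable e J)`; otherwise do nothing. For a set of beta numbers both
sets are bounded below, so that `sInf` is the minimum. -/
noncomputable def down (e : ℕ) (J : Set ℤ) : Set ℤ :=
  if (slidable e J).Nonempty then
    (J \ {sInf (downCandidates e J)}) ∪ {sInf (slidable e J) - (e : ℤ)}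
  else J

/-- The result of applying the down operation until no bead can be slid up, that is, for as many
steps as the least `n` with `slidable e ((down e)^[n] J) = ∅`. If the process does not stop the
value is `J`; hence `slidable e (base e J) = ∅` says exactly that the process stops. -/
noncomputable def base (e : ℕ) (J : Set ℤ) : Set ℤ :=
  (down e)^[sInf {n : ℕ | slidable e ((down e)^[n] J) = ∅}] J

/-! The base has a description that does not mention down steps: start from all integers below some
`N` with `Set.Iio N ⊆ J` and insert the remaining beads in increasing order with `insertBead`
(`base_eq_insertUpTo`). This holds because the result of the insertions is unchanged by a down step
(`insertUpTo_slide`), and a set without slidable beads is reproduced by them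
(`insertUpTo_eq_inter`). The greatest bead `j` is inserted last, so base(K ∪ {j}) = `insertBead e j`
(base K). The right side is the same for base K in place of K, since the base of a base is itself;
this is the proposition, and the row by row version iterates it.

For the invariance, put h = p' - e and L = J ∪ {h}. The down step moves the hole of L from h to q',
and the hole can travel through consecutive elements a < b of L. Here a + e is in J: it is p' if a =
h, and otherwise minimality of q' applies. The insertions with a omitted and with b omitted differ
only by `WindowRel`, which persists until the insertion of a + e erases it
(`insertUpTo_diff_consecutive`).

Restrictedness means that gaps are at most e. It supplies a bead strictly between p' - e and p', and
down steps preserve it. -/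

/-! ### Insertion of one bead -/

/-- Insertion of the bead `j` into `D`: in each window `[s, s + e)` with `s ≡ j` modulo `e` the
least element of `D` is replaced by `s`, for all `s < j`, and `j` is added. -/
def insertBead (e : ℕ) (j : ℤ) (D : Set ℤ) : Set ℤ :=
  {y | (y ≤ j ∧ (e : ℤ) ∣ j - y) ∨
    (y ∈ D ∧ ∃ s y', (e : ℤ) ∣ j - s ∧ s ≤ y' ∧ y' < y ∧ y < s + e ∧ y' ∈ D)}

theorem window_start_unique {e : ℕ} {j s t y : ℤ} (hs : (e : ℤ) ∣ j - s) (ht : (e : ℤ) ∣ j - t)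
    (h1 : s ≤ y) (h2 : y < s + e) (h3 : t ≤ y) (h4 : y < t + e) : s = t := by
  have h : (e : ℤ) ∣ s - t := by
    have := dvd_sub ht hs
    rwa [show j - t - (j - s) = s - t by ring] at this
  have := Int.eq_zero_of_abs_lt_dvd h (abs_lt.2 ⟨by omega, by omega⟩)
  omega

theorem exists_window_start {e : ℕ} (he : 0 < e) (j y : ℤ) :
    ∃ s, (e : ℤ) ∣ j - s ∧ s ≤ y ∧ y < s + e := by
  have he' : (0 : ℤ) < e := by exact_mod_cast he
  refine ⟨y - (y - j) % e, ?_, ?_, ?_⟩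
  · have := Int.dvd_self_sub_emod (x := y - j) (m := (e : ℤ))
    rw [show j - (y - (y - j) % (e : ℤ)) = -(y - j - (y - j) % e) by ring]
    exact (dvd_neg).2 this
  · have := Int.emod_nonneg (y - j) he'.ne'
    omega
  · have := Int.emod_lt_of_pos (y - j) he'
    omega

/-- Membership in `insertBead` for an element of a given window. -/
theorem mem_insertBead_window {e : ℕ} {j s y : ℤ} {D : Set ℤ} (hs : (e : ℤ) ∣ j - s)
    (hsj : s ≤ j) (h1 : s ≤ y) (h2 : y < s + e) :
    y ∈ insertBead e j D ↔ y = s ∨ (y ∈ D ∧ ∃ y' ∈ D, s ≤ y' ∧ y' < y) := by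
  constructor
  · rintro (⟨_, h⟩ | ⟨h, t, y', ht, h3, h4, h5, h6⟩)
    · exact Or.inl (window_start_unique hs h h1 h2 le_rfl (by omega)).symm
    · obtain rfl := window_start_unique hs ht h1 h2 (by omega) h5
      exact Or.inr ⟨h, y', h6, h3, h4⟩
  · rintro (rfl | ⟨h, y', h6, h3, h4⟩)
    · exact Or.inl ⟨hsj, hs⟩
    · exact Or.inr ⟨h, s, y', hs, h3, h4, h2, h6⟩

theorem insertBead_subset {e : ℕ} {j : ℤ} {D : Set ℤ} (h : ∀ y ∈ D, y < j) :
    ∀ y ∈ insertBead e j D, y ≤ j := by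
  rintro y (⟨h1, _⟩ | ⟨h1, _⟩)
  · exact h1
  · exact (h y h1).le

/-- If the runner of `j` is full below `j`, then insertion just adds `j`. -/
theorem insertBead_eq_union {e : ℕ} (he : 0 < e) {j : ℤ} {D : Set ℤ} (hD : ∀ y ∈ D, y < j)
    (h : ∀ y < j, (e : ℤ) ∣ j - y → y ∈ D) : insertBead e j D = D ∪ {j} := by
  ext y
  constructor
  · rintro (⟨h1, h2⟩ | ⟨h1, _⟩)
    · rcases h1.lt_or_eq with h1 | rfl
      · exact Or.inl (h y h1 h2)
      · exact Or.inr rfl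
    · exact Or.inl h1
  · rintro (hy | rfl)
    · obtain ⟨s, hs, h1, h2⟩ := exists_window_start he j y
      have hsj : s < j := by have := hD y hy; omega
      rw [mem_insertBead_window hs hsj.le h1 h2]
      rcases h1.lt_or_eq with h1 | rfl
      · exact Or.inr ⟨hy, s, h s hsj hs, le_rfl, h1⟩
      · exact Or.inl rfl
    · exact Or.inl ⟨le_rfl, by simp⟩

/-! ### Sets that differ only in the least elements of windows -/

/-- In each window `[s, s + e)` below `j`, with `s ≡ j` modulo `e`, the set `D'` either agrees
with `D` or arises from it by replacing the least element by `s`. -/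
def WindowRel (e : ℕ) (j : ℤ) (D D' : Set ℤ) : Prop :=
  ∀ s < j, (e : ℤ) ∣ j - s →
    (∀ y, s ≤ y → y < s + e → (y ∈ D' ↔ y ∈ D)) ∨
    (s ∈ D' ∧ ∃ t ∈ D, s ≤ t ∧ t < s + e ∧ (∀ y ∈ D, s ≤ y → t ≤ y) ∧
      ∀ y, s < y → y < s + e → (y ∈ D' ↔ y ∈ D ∧ t < y))

theorem le_sub_of_dvd_of_lt {e : ℕ} {j s : ℤ} (hs : (e : ℤ) ∣ j - s) (h : s < j) : s ≤ j - e := by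
  have := Int.le_of_dvd (by omega) hs
  omega

/-- Insertion discards the least element of each window in favour of `s`, and the least elements are
all in which the two sets differ. -/
theorem WindowRel.insertBead_eq {e : ℕ} (he : 0 < e) {j : ℤ} {D D' : Set ℤ}
    (h : WindowRel e j D D') (hD : ∀ y ∈ D, y < j) (hD' : ∀ y ∈ D', y < j) :
    insertBead e j D = insertBead e j D' := by
  ext y
  rcases lt_or_ge y j with hy | hy
  · obtain ⟨s, hs, h1, h2⟩ := exists_window_start he j y
    have hsj : s < j := by omega
    rw [mem_insertBead_window hs hsj.le h1 h2, mem_insertBead_window hs hsj.le h1 h2]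
    refine or_congr_right' fun hne => ?_
    rcases h s hsj hs with h | ⟨hs', t, ht, h3, h4, h5, h6⟩
    · rw [h y h1 h2]
      refine and_congr_right fun _ => exists_congr fun y' => ?_
      constructor
      · rintro ⟨h7, h8, h9⟩
        exact ⟨(h y' h8 (by omega)).2 h7, h8, h9⟩
      · rintro ⟨h7, h8, h9⟩
        exact ⟨(h y' h8 (by omega)).1 h7, h8, h9⟩
    · rw [h6 y (by omega) h2]
      constructor
      · rintro ⟨h7, y', h8, h9, h10⟩
        exact ⟨⟨h7, by have := h5 y' h8 h9; omega⟩, s, hs', le_rfl, by omega⟩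
      · rintro ⟨⟨h7, h8⟩, _⟩
        exact ⟨h7, t, ht, h3, h8⟩
  · constructor
    · intro h
      have := insertBead_subset hD y h
      obtain rfl : y = j := by omega
      exact Or.inl ⟨le_rfl, by simp⟩
    · intro h
      have := insertBead_subset hD' y h
      obtain rfl : y = j := by omega
      exact Or.inl ⟨le_rfl, by simp⟩

/-- The relation is preserved by insertion of a bead between `j - e` and `j`. -/
theorem WindowRel.insertBead {e : ℕ} {j x : ℤ} {D D' : Set ℤ} (h : WindowRel e j D D')
    (hx1 : j - e < x) (hx2 : x < j)
    (hne : ∀ s < j, (e : ℤ) ∣ j - s → ∃ y ∈ D, s ≤ y ∧ y < s + (x - j + e)) :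
    WindowRel e j (insertBead e x D) (insertBead e x D') := by
  -- By `hne` the least element `t` of a window lies below the point congruent to `x`, so the sets
  -- agree from that point on.
  have high : ∀ s < j, (e : ℤ) ∣ j - s → ∀ y, s + (x - j + e) ≤ y → y < s + e →
      (y ∈ D' ↔ y ∈ D) := by
    intro s hs hd y h1 h2
    rcases h s hs hd with h | ⟨_, t, ht, h3, h4, h5, h6⟩
    · exact h y (by omega) h2
    · obtain ⟨z, hz, h7, h8⟩ := hne s hs hd
      have := h5 z hz h7
      rw [h6 y (by omega) h2, and_iff_left (by omega)]
  intro s hs hd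
  have hse := le_sub_of_dvd_of_lt hd hs
  have hd2 : (e : ℤ) ∣ j - (s - e) := by
    rw [show j - (s - e) = j - s + e by ring]; exact dvd_add hd dvd_rfl
  -- `c` is the point of `[s, s + e)` congruent to `x`. It cuts the window into `[s, c)`, which ends
  -- the `x`-window starting at `c - e`, and `[c, s + e)`, which begins the next one.
  obtain ⟨c, hc⟩ : ∃ c, c = s + (x - j + e) := ⟨_, rfl⟩
  have hcx : c ≤ x := by omega
  have hc1 : s < c := by omega
  have hc2 : c < s + e := by omega
  have hdc : (e : ℤ) ∣ x - c := by
    rw [show x - c = j - s - e by rw [hc]; ring]; exact dvd_sub hd dvd_rfl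
  have hdc2 : (e : ℤ) ∣ x - (c - e) := by
    rw [show x - (c - e) = j - s by rw [hc]; ring]; exact hd
  have memHigh : ∀ (X : Set ℤ) y, c ≤ y → y < s + e →
      (y ∈ _root_.insertBead e x X ↔ y = c ∨ (y ∈ X ∧ ∃ y' ∈ X, c ≤ y' ∧ y' < y)) :=
    fun X y h1 h2 => mem_insertBead_window hdc hcx h1 (by omega)
  have memLow : ∀ (X : Set ℤ) y, s ≤ y → y < c →
      (y ∈ _root_.insertBead e x X ↔ (y ∈ X ∧ ∃ y' ∈ X, c - e ≤ y' ∧ y' < y)) := by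
    intro X y h1 h2
    rw [mem_insertBead_window hdc2 (by omega) (by omega) (by omega), or_iff_right (by omega)]
  have eqHigh : ∀ y, c ≤ y → y < s + e →
      (y ∈ _root_.insertBead e x D' ↔ y ∈ _root_.insertBead e x D) := by
    intro y h1 h2
    rw [memHigh _ y h1 h2, memHigh _ y h1 h2, high s hs hd y (by omega) h2]
    refine or_congr_right (and_congr_right fun _ => exists_congr fun y' => ?_)
    constructor
    · rintro ⟨h7, h8, h9⟩
      exact ⟨(high s hs hd y' (by omega) (by omega)).1 h7, h8, h9⟩
    · rintro ⟨h7, h8, h9⟩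
      exact ⟨(high s hs hd y' (by omega) (by omega)).2 h7, h8, h9⟩
  have prev : ∀ y, c - e ≤ y → y < s → (y ∈ D' ↔ y ∈ D) := fun y h1 h2 =>
    high (s - e) (by omega) hd2 y (by omega) (by omega)
  rcases h s hs hd with h | ⟨hs', t, ht, h3, h4, h5, h6⟩
  · left
    intro y h1 h2
    rcases lt_or_ge y c with hy | hy
    · rw [memLow _ y h1 hy, memLow _ y h1 hy, h y h1 h2]
      refine and_congr_right fun _ => exists_congr fun y' => ?_
      have key : c - e ≤ y' → y' < y → (y' ∈ D' ↔ y' ∈ D) := by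
        intro h8 h9
        rcases lt_or_ge y' s with h10 | h10
        · exact prev y' h8 h10
        · exact h y' h10 (by omega)
      constructor
      · rintro ⟨h7, h8, h9⟩
        exact ⟨(key h8 h9).1 h7, h8, h9⟩
      · rintro ⟨h7, h8, h9⟩
        exact ⟨(key h8 h9).2 h7, h8, h9⟩
    · exact eqHigh y hy h2
  · have htc : t < c := by
      obtain ⟨z, hz, h7, h8⟩ := hne s hs hd
      have := h5 z hz h7
      omega
    -- With a bead in `[c - e, s)`, the insertion discards nothing from `[s, c)` and the difference
    -- survives. Otherwise `t` and `s` are the least elements of their `x`-windows; both are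
    -- discarded and the difference disappears.
    by_cases hex : ∃ z ∈ D, c - e ≤ z ∧ z < s
    · right
      obtain ⟨z, hz, hz1, hz2⟩ := hex
      have hz' := (prev z hz1 hz2).2 hz
      refine ⟨(memLow _ s le_rfl hc1).2 ⟨hs', z, hz', hz1, hz2⟩, t,
        (memLow _ t h3 htc).2 ⟨ht, z, hz, hz1, by omega⟩, h3, h4, ?_, ?_⟩
      · intro y hy h1
        rcases lt_or_ge y c with hyc | hyc
        · exact h5 y ((memLow _ y h1 hyc).1 hy).1 h1
        · omega
      · intro y h1 h2
        rcases lt_or_ge y c with hyc | hyc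
        · rw [memLow _ y h1.le hyc, memLow _ y h1.le hyc, h6 y h1 h2]
          constructor
          · rintro ⟨⟨h7, h8⟩, _⟩
            exact ⟨⟨h7, z, hz, hz1, by omega⟩, h8⟩
          · rintro ⟨⟨h7, _⟩, h8⟩
            exact ⟨⟨h7, h8⟩, z, hz', hz1, by omega⟩
        · rw [eqHigh y hyc h2, and_iff_left (by omega)]
    · left
      push Not at hex
      intro y h1 h2
      rcases lt_or_ge y c with hyc | hyc
      · rw [memLow _ y h1 hyc, memLow _ y h1 hyc]
        constructor
        · rintro ⟨h7, z, hz, hz1, hz2⟩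
          have hsz : s ≤ z := by
            by_contra hlt
            exact hlt (hex z ((prev z hz1 (by omega)).1 hz) hz1)
          have := (h6 y (by omega) h2).1 h7
          exact ⟨this.1, t, ht, by omega, this.2⟩
        · rintro ⟨h7, z, hz, hz1, hz2⟩
          have hsz : s ≤ z := hex z hz hz1
          have := h5 z hz hsz
          exact ⟨(h6 y (by omega) h2).2 ⟨h7, by omega⟩, s, hs', by omega, by omega⟩
      · exact eqHigh y hyc h2

/-- This is where the difference is created: one side receives `q`, whose full runner makes the
insertion a mere addition, and the other receives `a`. -/
theorem windowRel_union_insertBead {e : ℕ} {a q : ℤ} {D : Set ℤ}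
    (hD : ∀ y ∈ D, y < a) (haq : a < q) (hqa : q < a + e)
    (hq : ∀ y < q, (e : ℤ) ∣ q - y → y ∈ D) :
    WindowRel e (a + e) (D ∪ {q}) (insertBead e a D) := by
  intro s hs hd
  have hda : (e : ℤ) ∣ a - s := by
    rw [show a - s = a + e - s - e by ring]; exact dvd_sub hd dvd_rfl
  have hsa : s ≤ a := by have := le_sub_of_dvd_of_lt hd hs; omega
  have mem : ∀ y, s ≤ y → y < s + e → _ := fun y h1 h2 =>
    mem_insertBead_window (D := D) hda hsa h1 h2
  right
  refine ⟨(mem s le_rfl (by omega)).2 (Or.inl rfl), ?_⟩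
  rcases hsa.lt_or_eq with hsa | rfl
  · have hse := le_sub_of_dvd_of_lt hda hsa
    -- `r` is the point of the window on the runner of `q`; it shows that `D` meets the window.
    obtain ⟨r, hr⟩ : ∃ r, r = s + (q - a) := ⟨_, rfl⟩
    have hrD : r ∈ D := hq r (by omega) (by
      rwa [hr, show q - (s + (q - a)) = a - s by ring])
    obtain ⟨t, ⟨ht, hst⟩, hmin⟩ := Int.exists_least_of_bdd (P := fun z => z ∈ D ∧ s ≤ z)
      ⟨s, fun z hz => hz.2⟩ ⟨r, hrD, by omega⟩
    have htr := hmin r ⟨hrD, by omega⟩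
    refine ⟨t, Or.inl ht, hst, by omega, ?_, ?_⟩
    · rintro y (hy | rfl) h1
      · exact hmin y ⟨hy, h1⟩
      · omega
    · intro y h1 h2
      rw [mem y h1.le h2]
      constructor
      · rintro (rfl | ⟨h3, y', h4, h5, h6⟩)
        · omega
        · exact ⟨Or.inl h3, by have := hmin y' ⟨h4, h5⟩; omega⟩
      · rintro ⟨h3 | rfl, h4⟩
        · exact Or.inr ⟨h3, t, ht, hst, h4⟩
        · omega
  -- In the top window `s = a` there are no elements of `D`: the least element is `q`, against `a`
  -- on the other side.
  · refine ⟨q, Or.inr rfl, haq.le, hqa, ?_, ?_⟩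
    · rintro y (hy | rfl) h1
      · have := hD y hy; omega
      · exact le_rfl
    · intro y h1 h2
      rw [mem y h1.le h2]
      constructor
      · rintro (rfl | ⟨h3, _⟩)
        · omega
        · have := hD y h3; omega
      · rintro ⟨h3 | rfl, h4⟩
        · have := hD y h3; omega
        · omega

/-! ### Insertion of the beads in increasing order -/

open Classical in
/-- Starting from `{x | x < N}`, insert the elements of `J` in `[N, z)` in increasing order. -/
noncomputable def insertUpTo (e : ℕ) (N : ℤ) (J : Set ℤ) (z : ℤ) : Set ℤ :=
  Nat.rec (Set.Iio N)
    (fun n D => if N + (n : ℤ) ∈ J then insertBead e (N + n) D else D) (z - N).toNat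

theorem insertUpTo_self (e : ℕ) (N : ℤ) (J : Set ℤ) : insertUpTo e N J N = Set.Iio N := by
  simp [insertUpTo]

open Classical in
theorem insertUpTo_succ (e : ℕ) {N : ℤ} (J : Set ℤ) {z : ℤ} (hz : N ≤ z) :
    insertUpTo e N J (z + 1) =
      if z ∈ J then insertBead e z (insertUpTo e N J z) else insertUpTo e N J z := by
  obtain ⟨n, rfl⟩ : ∃ n : ℕ, z = N + n := ⟨(z - N).toNat, by omega⟩
  have h1 : (N + (n : ℤ) + 1 - N).toNat = n + 1 := by omega
  have h2 : (N + (n : ℤ) - N).toNat = n := by omega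
  simp only [insertUpTo, h1, h2]

theorem insertUpTo_succ_of_mem (e : ℕ) {N : ℤ} {J : Set ℤ} {z : ℤ} (hz : N ≤ z) (h : z ∈ J) :
    insertUpTo e N J (z + 1) = insertBead e z (insertUpTo e N J z) := by
  rw [insertUpTo_succ e J hz, if_pos h]

theorem insertUpTo_succ_of_notMem (e : ℕ) {N : ℤ} {J : Set ℤ} {z : ℤ} (hz : N ≤ z) (h : z ∉ J) :
    insertUpTo e N J (z + 1) = insertUpTo e N J z := by
  rw [insertUpTo_succ e J hz, if_neg h]

theorem insertUpTo_congr {e : ℕ} {N a z : ℤ} {J J' : Set ℤ} (ha : N ≤ a) (haz : a ≤ z)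
    (h0 : insertUpTo e N J a = insertUpTo e N J' a)
    (h : ∀ y, a ≤ y → y < z → (y ∈ J ↔ y ∈ J')) :
    insertUpTo e N J z = insertUpTo e N J' z := by
  induction z, haz using Int.leInduction with
  | base => exact h0
  | succ z hz ih =>
    have ih := ih fun y h1 h2 => h y h1 (by omega)
    rw [insertUpTo_succ e J (ha.trans hz), insertUpTo_succ e J' (ha.trans hz), ih]
    have hz' := h z hz (by omega)
    by_cases hJ : z ∈ J
    · rw [if_pos hJ, if_pos (hz'.1 hJ)]
    · rw [if_neg hJ, if_neg fun h' => hJ (hz'.2 h')]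

theorem insertUpTo_congr_below {e : ℕ} {N z : ℤ} {J J' : Set ℤ} (hz : N ≤ z)
    (h : ∀ y < z, (y ∈ J ↔ y ∈ J')) : insertUpTo e N J z = insertUpTo e N J' z :=
  insertUpTo_congr le_rfl hz (by rw [insertUpTo_self, insertUpTo_self]) fun y _ hy => h y hy

theorem insertUpTo_eq_of_disjoint {e : ℕ} {N a z : ℤ} {J : Set ℤ} (ha : N ≤ a) (haz : a ≤ z)
    (h : ∀ y, a ≤ y → y < z → y ∉ J) : insertUpTo e N J z = insertUpTo e N J a := by
  induction z, haz using Int.leInduction with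
  | base => rfl
  | succ z hz ih =>
    rw [insertUpTo_succ_of_notMem e (ha.trans hz) (h z hz (by omega)),
      ih fun y h1 h2 => h y h1 (by omega)]

theorem lt_of_mem_insertUpTo {e : ℕ} {N z : ℤ} {J : Set ℤ} (hz : N ≤ z) :
    ∀ y ∈ insertUpTo e N J z, y < z := by
  induction z, hz using Int.leInduction with
  | base => rw [insertUpTo_self]; exact fun y hy => hy
  | succ z hz ih =>
    intro y hy
    by_cases hJ : z ∈ J
    · rw [insertUpTo_succ_of_mem e hz hJ] at hy
      have := insertBead_subset ih y hy
      omega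
    · rw [insertUpTo_succ_of_notMem e hz hJ] at hy
      have := ih y hy
      omega

/-- Below `z` every runner of a set without slidable beads below `z` is full. -/
theorem mem_of_dvd_sub {e : ℕ} {J : Set ℤ} {z x y : ℤ} (h : ∀ x ∈ J, x < z → x - (e : ℤ) ∈ J)
    (hx : x ∈ J) (hxz : x < z) (hy : y ≤ x) (hd : (e : ℤ) ∣ x - y) : y ∈ J := by
  obtain ⟨k, hk⟩ := hd
  rcases Nat.eq_zero_or_pos e with rfl | he
  · have : y = x := by simp at hk; omega
    rwa [this]
  have hk0 : 0 ≤ k := by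
    by_contra hneg
    have : (e : ℤ) * k < 0 := mul_neg_of_pos_of_neg (by exact_mod_cast he) (by omega)
    omega
  have key : ∀ n : ℕ, x - (e : ℤ) * n ∈ J := by
    intro n
    induction n with
    | zero => simpa using hx
    | succ n ih =>
      have h0 : (0 : ℤ) ≤ (e : ℤ) * n := by positivity
      have := h _ ih (by omega)
      rwa [show x - (e : ℤ) * n - e = x - (e : ℤ) * ((n + 1 : ℕ) : ℤ) by push_cast; ring] at this
  have := key k.toNat
  rwa [Int.toNat_of_nonneg hk0, ← hk, sub_sub_cancel] at this

/-- Insertion of the beads of a set without slidable beads below `z` reproduces this set. -/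
theorem insertUpTo_eq_inter {e : ℕ} (he : 0 < e) {N z : ℤ} {J : Set ℤ} (hN : Set.Iio N ⊆ J)
    (hz : N ≤ z) (h : ∀ x ∈ J, x < z → x - (e : ℤ) ∈ J) :
    insertUpTo e N J z = J ∩ Set.Iio z := by
  induction z, hz using Int.leInduction with
  | base => rw [insertUpTo_self, Set.inter_eq_right.2 hN]
  | succ z hz ih =>
    have ih := ih fun x hx hxz => h x hx (by omega)
    by_cases hJ : z ∈ J
    · rw [insertUpTo_succ_of_mem e hz hJ, ih, insertBead_eq_union he (D := J ∩ Set.Iio z)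
        (fun y hy => hy.2) fun y hy hd => ⟨mem_of_dvd_sub h hJ (by omega) hy.le hd, hy⟩]
      ext y
      simp only [Set.mem_union, Set.mem_inter_iff, Set.mem_Iio, Set.mem_singleton_iff]
      constructor
      · rintro (⟨h1, h2⟩ | rfl)
        · exact ⟨h1, by omega⟩
        · exact ⟨hJ, by omega⟩
      · rintro ⟨h1, h2⟩
        rcases (show y < z ∨ y = z by omega) with h3 | h3
        · exact Or.inl ⟨h1, h3⟩
        · exact Or.inr h3
    · rw [insertUpTo_succ_of_notMem e hz hJ, ih]
      ext y
      simp only [Set.mem_inter_iff, Set.mem_Iio]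
      refine and_congr_right fun hy => ?_
      have : y ≠ z := fun h => hJ (h ▸ hy)
      omega

/-! ### Invariance of the insertions under a down step -/

/-- The relation `WindowRel` is preserved by insertion of beads between `q` and `j`. -/
theorem windowRel_insertUpTo {e : ℕ} {N q j z : ℤ} {J J' : Set ℤ} (hNq : N ≤ q) (hqz : q < z)
    (hzj : z ≤ j) (hqj : j - e < q)
    (h : ∀ y, q < y → y < z → (y ∈ J ↔ y ∈ J'))
    (hq : ∀ y ≤ q, (e : ℤ) ∣ q - y → y ∈ insertUpTo e N J (q + 1))
    (h0 : WindowRel e j (insertUpTo e N J (q + 1)) (insertUpTo e N J' (q + 1))) :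
    WindowRel e j (insertUpTo e N J z) (insertUpTo e N J' z) := by
  have hqz' : q + 1 ≤ z := hqz
  -- The second clause is the hypothesis `hne` of `WindowRel.insertBead`. It is witnessed by the
  -- runner of the bead inserted last, at first that of `q`.
  suffices H : WindowRel e j (insertUpTo e N J z) (insertUpTo e N J' z) ∧
      ∀ s < j, (e : ℤ) ∣ j - s → ∃ y ∈ insertUpTo e N J z, s ≤ y ∧ y < s + (z - j + e) from H.1
  clear hqz
  induction z, hqz' using Int.leInduction with
  | base =>
    refine ⟨h0, fun s hs hd => ⟨s + (q - j + e), hq _ ?_ ?_, by omega, by omega⟩⟩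
    · have := le_sub_of_dvd_of_lt hd hs
      omega
    · rw [show q - (s + (q - j + e)) = j - s - e by ring]
      exact dvd_sub hd dvd_rfl
  | succ z hz ih =>
    obtain ⟨ih1, ih2⟩ := ih (by omega) fun y h1 h2 => h y h1 (by omega)
    by_cases hJ : z ∈ J
    · rw [insertUpTo_succ_of_mem e (by omega) hJ,
        insertUpTo_succ_of_mem e (by omega) ((h z (by omega) (by omega)).1 hJ)]
      refine ⟨ih1.insertBead (by omega) (by omega) ih2, fun s hs hd =>
        ⟨s + (z - j + e), Or.inl ⟨?_, ?_⟩, by omega, by omega⟩⟩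
      · have := le_sub_of_dvd_of_lt hd hs
        omega
      · rw [show z - (s + (z - j + e)) = j - s - e by ring]
        exact dvd_sub hd dvd_rfl
    · rw [insertUpTo_succ_of_notMem e (by omega) hJ,
        insertUpTo_succ_of_notMem e (by omega)
          fun h' => hJ ((h z (by omega) (by omega)).2 h')]
      refine ⟨ih1, fun s hs hd => ?_⟩
      obtain ⟨y, h1, h2, h3⟩ := ih2 s hs hd
      exact ⟨y, h1, h2, by omega⟩

/-- After insertion of the beads of `J` below `z`, the runner of an element of `J` which is not
the next to be inserted is still full below it. Here all beads of `J` in `(h, h + e)` can be slid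
up to beads below `h`. -/
theorem mem_insertUpTo_of_exists_lt {e : ℕ} (he : 0 < e) {N h z : ℤ} {J : Set ℤ}
    (hN : Set.Iio N ⊆ J) (hNh : N ≤ h) (hh : h ∈ J)
    (hcore : ∀ x ∈ J, x < h + e → x ≠ h → x - (e : ℤ) ∈ J)
    (hhz : h < z) :
    ∀ v ∈ J, v ≤ h + e → (∃ w ∈ J, z ≤ w ∧ w < v) → ∀ y < v, (e : ℤ) ∣ v - y →
      y ∈ insertUpTo e N J z := by
  have hhz' : h + 1 ≤ z := hhz
  clear hhz
  induction z, hhz' using Int.leInduction with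
  | base =>
    rintro v hv hve ⟨w, hw, hzw, hwv⟩ y hyv hd
    rw [insertUpTo_succ_of_mem e hNh hh,
      insertUpTo_eq_inter he hN hNh fun x hx hxh => hcore x hx (by omega) (by omega)]
    have full : ∀ v ∈ J, h < v → v < h + e → ∀ y < v, (e : ℤ) ∣ v - y → y ∈ J ∩ Set.Iio h := by
      intro v hv hhv hve y hyv hd
      have h1 := le_sub_of_dvd_of_lt hd hyv
      refine ⟨mem_of_dvd_sub (z := h) (fun x hx hxh => hcore x hx (by omega) (by omega))
        (hcore v hv hve (by omega)) (by omega) h1 ?_, by simp only [Set.mem_Iio]; omega⟩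
      rw [show v - e - y = v - y - e by ring]
      exact dvd_sub hd dvd_rfl
    rcases hve.lt_or_eq with hve | rfl
    -- The translate of `w` by `y - v` is a smaller element of the window of `y`, so `y` is not
    -- least and survives the insertion of `h`.
    · refine Or.inr ⟨full v hv (by omega) hve y hyv hd, h - (v - y), w - (v - y), ?_, by omega,
        by omega, by omega, full w hw (by omega) (by omega) _ (by omega) ?_⟩
      · rwa [sub_sub_cancel]
      · rwa [sub_sub_cancel]
    · refine Or.inl ⟨?_, ?_⟩
      · have := le_sub_of_dvd_of_lt hd hyv
        omega
      · rw [show h - y = h + e - y - e by ring]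
        exact dvd_sub hd dvd_rfl
  | succ z hz ih =>
    rintro v hv hve ⟨w, hw, hzw, hwv⟩ y hyv hd
    have h1 := ih v hv hve ⟨w, hw, by omega, hwv⟩ y hyv hd
    by_cases hJ : z ∈ J
    · rw [insertUpTo_succ_of_mem e (by omega) hJ]
      -- The same translation argument; the induction hypothesis applies to `w` because `z` itself
      -- is a bead below it still to be inserted.
      refine Or.inr ⟨h1, z - (v - y), w - (v - y), ?_, by omega,
        by omega, by omega, ih w hw (by omega) ⟨z, hJ, le_rfl, by omega⟩ _ (by omega) ?_⟩
      · rwa [sub_sub_cancel]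
      · rwa [sub_sub_cancel]
    · rwa [insertUpTo_succ_of_notMem e (by omega) hJ]

/-- Removing either of two consecutive elements `a < q` of `J` gives the same result, provided
that `a + e` is in `J`. -/
theorem insertUpTo_diff_consecutive {e : ℕ} (he : 0 < e) {N h a q : ℤ} {J : Set ℤ}
    (hN : Set.Iio N ⊆ J) (hNh : N ≤ h) (hh : h ∈ J)
    (hcore : ∀ x ∈ J, x < h + e → x ≠ h → x - (e : ℤ) ∈ J)
    (ha : a ∈ J) (hq : q ∈ J) (hha : h ≤ a) (haq : a < q) (hqh : q ≤ h + e) (hqa : q < a + e)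
    (hae : a + e ∈ J) (hcons : ∀ y ∈ J, a < y → q ≤ y) :
    insertUpTo e N (J \ {a}) (a + e + 1) = insertUpTo e N (J \ {q}) (a + e + 1) := by
  have hNa : N ≤ a := by omega
  have e1 : insertUpTo e N (J \ {a}) a = insertUpTo e N J a :=
    insertUpTo_congr_below hNa fun y hy => by simp [hy.ne]
  have e2 : insertUpTo e N (J \ {q}) a = insertUpTo e N J a :=
    insertUpTo_congr_below hNa fun y hy => by simp [(hy.trans haq).ne]
  obtain ⟨D, hD⟩ : ∃ D, D = insertUpTo e N J a := ⟨_, rfl⟩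
  have hDa : ∀ y ∈ D, y < a := by rw [hD]; exact lt_of_mem_insertUpTo hNa
  have hqD : ∀ y < q, (e : ℤ) ∣ q - y → y ∈ D := by
    rw [hD]
    rcases hha.lt_or_eq with hha | rfl
    · exact mem_insertUpTo_of_exists_lt he hN hNh hh hcore hha q hq hqh ⟨a, ha, le_rfl, haq⟩
    · rw [insertUpTo_eq_inter he hN hNh fun x hx hxh => hcore x hx (by omega) (by omega)]
      intro y hyq hd
      have h1 := le_sub_of_dvd_of_lt hd hyq
      refine ⟨mem_of_dvd_sub (z := h) (fun x hx hxh => hcore x hx (by omega) (by omega))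
        (hcore q hq hqa (by omega)) (by omega) h1 ?_, by simp only [Set.mem_Iio]; omega⟩
      rw [show q - e - y = q - y - e by ring]
      exact dvd_sub hd dvd_rfl
  have f1 : insertUpTo e N (J \ {a}) (q + 1) = D ∪ {q} := by
    rw [insertUpTo_succ_of_mem (J := J \ {a}) e (by omega) ⟨hq, haq.ne'⟩,
      insertUpTo_eq_of_disjoint hNa haq.le, e1, ← hD,
      insertBead_eq_union he (fun y hy => (hDa y hy).trans haq) hqD]
    rintro y h1 h2 ⟨hy, hya⟩
    have := hcons y hy (lt_of_le_of_ne h1 (Ne.symm hya))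
    omega
  have f2 : insertUpTo e N (J \ {q}) (q + 1) = insertBead e a D := by
    rw [insertUpTo_eq_of_disjoint (a := a + 1) (by omega) (by omega),
      insertUpTo_succ_of_mem (J := J \ {q}) e hNa ⟨ha, haq.ne⟩, e2, ← hD]
    rintro y h1 h2 ⟨hy, hya⟩
    have := hcons y hy (by omega)
    exact hya (by simp only [Set.mem_singleton_iff]; omega)
  have rel : WindowRel e (a + e) (insertUpTo e N (J \ {a}) (a + e))
      (insertUpTo e N (J \ {q}) (a + e)) := by
    refine windowRel_insertUpTo (q := q) (by omega) hqa le_rfl (by omega) ?_ ?_ ?_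
    · intro y h1 h2
      simp [h1.ne', (haq.trans h1).ne']
    · rw [f1]
      intro y hy hd
      rcases hy.lt_or_eq with hy | rfl
      · exact Or.inl (hqD y hy hd)
      · exact Or.inr rfl
    · rw [f1, f2]
      exact windowRel_union_insertBead hDa haq hqa hqD
  have he' : (0 : ℤ) < e := by exact_mod_cast he
  rw [insertUpTo_succ_of_mem (J := J \ {a}) e (by omega) ⟨hae, by simp [he.ne']⟩,
    insertUpTo_succ_of_mem (J := J \ {q}) e (by omega) ⟨hae, by simp [hqa.ne']⟩,
    rel.insertBead_eq he (lt_of_mem_insertUpTo (by omega)) (lt_of_mem_insertUpTo (by omega))]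

/-- A down step does not change the result of the insertions. -/
theorem insertUpTo_slide {e : ℕ} (he : 0 < e) {N p q z : ℤ} {J : Set ℤ}
    (hN : Set.Iio N ⊆ J) (hpJ : p ∈ J) (hp : p - (e : ℤ) ∉ J)
    (hcore : ∀ x ∈ J, x < p → x - (e : ℤ) ∈ J)
    (hgap : ∃ u ∈ J, p - e < u ∧ u < p)
    (hq : q ∈ J) (hpq : p - e < q) (hqp : q ≤ p)
    (hfull : ∀ x ∈ J, p - e < x → x < q → x + (e : ℤ) ∈ J) (hz : ∀ x ∈ J, x < z) :
    insertUpTo e N J z = insertUpTo e N ((J \ {q}) ∪ {p - (e : ℤ)}) z := by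
  obtain ⟨h, rfl⟩ : ∃ h, p = h + e := ⟨p - e, by ring⟩
  simp only [add_sub_cancel_right] at *
  have hNh : N ≤ h := by
    by_contra hlt
    exact hp (hN (by simpa using hlt))
  have he' : (0 : ℤ) < e := by exact_mod_cast he
  obtain ⟨L, hL⟩ : ∃ L, L = J ∪ {h} := ⟨_, rfl⟩
  have hLh : L \ {h} = J := by
    ext y
    simp only [hL, Set.mem_sdiff, Set.mem_union, Set.mem_singleton_iff]
    constructor
    · rintro ⟨h1 | h1, h2⟩
      · exact h1
      · exact absurd h1 h2
    · exact fun h1 => ⟨Or.inl h1, fun h2 => hp (h2 ▸ h1)⟩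
  have hLq : L \ {q} = J \ {q} ∪ {h} := by
    rw [hL, Set.union_sdiff_distrib, Set.sdiff_singleton_eq_self (a := q) (s := {h})
      (by simpa using hpq.ne')]
  have hNL : Set.Iio N ⊆ L := fun y hy => hL ▸ Or.inl (hN hy)
  have hhL : h ∈ L := hL ▸ Or.inr rfl
  have hJL : ∀ y ∈ J, y ∈ L := fun y hy => hL ▸ Or.inl hy
  have hLJ : ∀ y ∈ L, y ≠ h → y ∈ J := by
    rw [hL]; rintro y (hy | hy) hne
    · exact hy
    · exact absurd hy hne
  have hcoreL : ∀ x ∈ L, x < h + e → x ≠ h → x - (e : ℤ) ∈ L :=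
    fun x hx h1 h2 => hJL _ (hcore x (hLJ x hx h2) h1)
  -- The hole sits at the greatest element `a` of `L` in `[h, v]`; as `v` grows to `q`, it moves
  -- from `h` to `q`.
  have key : ∀ v, h ≤ v → v ≤ q → ∃ a ∈ L, h ≤ a ∧ a ≤ v ∧ (∀ y ∈ L, a < y → v < y) ∧
      insertUpTo e N J z = insertUpTo e N (L \ {a}) z := by
    intro v hv
    induction v, hv using Int.leInduction with
    | base => exact fun _ => ⟨h, hhL, le_rfl, le_rfl, fun _ _ h1 => h1, by rw [hLh]⟩
    | succ v hv ih =>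
      intro hvq
      obtain ⟨a, haL, hha, hav, hcons, heq⟩ := ih (by omega)
      by_cases hvL : v + 1 ∈ L
      · have hae : a + e ∈ J := by
          rcases hha.lt_or_eq with hha | rfl
          · exact hfull a (hLJ a haL hha.ne') hha (by omega)
          · exact hpJ
        refine ⟨v + 1, hvL, by omega, le_rfl, fun _ _ h1 => h1, heq.trans ?_⟩
        -- For `a = h` the bead `u` of `hgap` bounds the next element of `L`.
        have hqa : v + 1 < a + e := by
          rcases hha.lt_or_eq with hha | rfl
          · omega
          · obtain ⟨u, hu, h1, h2⟩ := hgap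
            have := hcons u (hJL u hu) h1
            by_contra hlt
            have hu' := hfull u hu h1
            omega
        have := hz _ hae
        refine insertUpTo_congr (a := a + e + 1) (by omega) (by omega)
          (insertUpTo_diff_consecutive he hNL hNh hhL hcoreL haL hvL hha (by omega) (by omega)
            hqa (hJL _ hae) fun y hy h1 => hcons y hy h1) fun y h1 h2 => ?_
        simp [show y ≠ a by omega, show y ≠ v + 1 by omega]
      · refine ⟨a, haL, hha, by omega, fun y hy h1 => ?_, heq⟩
        have := hcons y hy h1
        have : y ≠ v + 1 := fun h2 => hvL (h2 ▸ hy)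
        omega
  obtain ⟨a, haL, hha, haq, hcons, heq⟩ := key q hpq.le le_rfl
  have : a = q := by
    by_contra hne
    have := hcons q (hJL q hq) (by omega)
    omega
  rw [heq, this, hLq]

/-! ### Down steps on sets with small gaps -/

/-- The data of a down step at a set with a slidable bead. -/
theorem exists_down_eq {e : ℕ} (he : 0 < e) {N : ℤ} {J : Set ℤ} (hN : Set.Iio N ⊆ J)
    (hU : (slidable e J).Nonempty) :
    ∃ p q, p ∈ J ∧ p - (e : ℤ) ∉ J ∧ (∀ x ∈ J, x < p → x - (e : ℤ) ∈ J) ∧ q ∈ J ∧ p - e < q ∧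
      q ≤ p ∧ (q = p ∨ q + (e : ℤ) ∉ J) ∧ (∀ x ∈ J, p - e < x → x < q → x + (e : ℤ) ∈ J) ∧
      down e J = (J \ {q}) ∪ {p - (e : ℤ)} := by
  have he' : (0 : ℤ) < e := by exact_mod_cast he
  have hUb : BddBelow (slidable e J) := by
    refine ⟨N, fun x hx => ?_⟩
    by_contra hlt
    exact hx.2 (hN (by simp only [Set.mem_Iio]; omega))
  have hp := Int.csInf_mem hU hUb
  have hmin : ∀ x ∈ slidable e J, sInf (slidable e J) ≤ x := fun x hx => csInf_le hUb hx
  have hdown : down e J = (J \ {sInf (downCandidates e J)}) ∪ {sInf (slidable e J) - (e : ℤ)} :=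
    if_pos hU
  have hCb : BddBelow (downCandidates e J) := by
    refine ⟨sInf (slidable e J) - e, fun x hx => ?_⟩
    rcases hx with hx | rfl
    · exact hx.1.le
    · omega
  have hpC : sInf (slidable e J) ∈ downCandidates e J := Or.inr rfl
  have hq := Int.csInf_mem ⟨_, hpC⟩ hCb
  have hqmin : ∀ x ∈ downCandidates e J, sInf (downCandidates e J) ≤ x :=
    fun x hx => csInf_le hCb hx
  refine ⟨_, _, hp.1, hp.2, ?_, ?_, ?_, hqmin _ hpC, ?_, ?_, hdown⟩
  · intro x hx hxp
    by_contra hxe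
    have := hmin x ⟨hx, hxe⟩
    omega
  · rcases hq with hq | hq
    · exact hq.2.1
    · rw [hq]; exact hp.1
  · rcases hq with hq | hq
    · exact hq.1
    · rw [hq]; omega
  · rcases hq with hq | hq
    · exact Or.inr hq.2.2
    · exact Or.inl hq
  · intro x hx h1 h2
    by_contra h3
    have := hqmin x (Or.inl ⟨h1, hx, h3⟩)
    omega

theorem down_eq_self {e : ℕ} {J : Set ℤ} (h : slidable e J = ∅) : down e J = J :=
  if_neg (by rw [h]; exact Set.not_nonempty_empty)

/-- `J` consists of all integers less than `N` and of the finitely many elements of `F`, which are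
at least `N`, and gaps between consecutive elements of `J` are at most `e`. -/
structure IsBeadSet (e : ℕ) (N : ℤ) (F : Finset ℤ) (J : Set ℤ) : Prop where
  le : ∀ x ∈ F, N ≤ x
  eq : J = Set.Iio N ∪ ↑F
  gap : ∀ y ∈ J, ∃ y' ∈ J, y - e ≤ y' ∧ y' < y

theorem IsBeadSet.Iio_subset {e : ℕ} {N : ℤ} {F : Finset ℤ} {J : Set ℤ} (h : IsBeadSet e N F J) :
    Set.Iio N ⊆ J := by
  rw [h.eq]; exact Set.subset_union_left

theorem IsBeadSet.mem_finset {e : ℕ} {N : ℤ} {F : Finset ℤ} {J : Set ℤ} (h : IsBeadSet e N F J)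
    {x : ℤ} : x ∈ F ↔ x ∈ J ∧ N ≤ x := by
  rw [h.eq]
  simp only [Set.mem_union, Set.mem_Iio, Finset.mem_coe]
  constructor
  · exact fun hx => ⟨Or.inr hx, h.le x hx⟩
  · rintro ⟨hx | hx, h2⟩
    · omega
    · exact hx

/-- A down step at a set with a slidable bead and small gaps keeps the number of beads, the
greatest bead, the smallness of the gaps, and the result of the insertions. -/
theorem IsBeadSet.down {e : ℕ} (he : 0 < e) {N : ℤ} {F : Finset ℤ} {J : Set ℤ}
    (h : IsBeadSet e N F J) (hU : (slidable e J).Nonempty) :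
    ∃ F', IsBeadSet e N F' (down e J) ∧ F'.card = F.card ∧
      ∑ x ∈ F', (x - N).toNat < ∑ x ∈ F, (x - N).toNat ∧
      (∀ j, IsGreatest J j → IsGreatest (down e J) j) ∧
      ∀ z, (∀ x ∈ J, x < z) → insertUpTo e N J z = insertUpTo e N (down e J) z := by
  have he' : (0 : ℤ) < e := by exact_mod_cast he
  have hN := h.Iio_subset
  obtain ⟨p, q, hp, hpe, hcore, hq, hpq, hqp, hqe, hfull, hdown⟩ := exists_down_eq he hN hU
  have hpN : N ≤ p - e := by
    by_contra hlt
    exact hpe (hN (by simpa using hlt))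
  obtain ⟨u, hu, hpu, hup⟩ : ∃ u ∈ J, p - e < u ∧ u < p := by
    obtain ⟨u, hu, h1, h2⟩ := h.gap p hp
    exact ⟨u, hu, lt_of_le_of_ne h1 fun h3 => hpe (h3 ▸ hu), h2⟩
  have hqF : q ∈ F := h.mem_finset.2 ⟨hq, by omega⟩
  have hpF : p - (e : ℤ) ∉ F.erase q := fun h1 =>
    hpe (h.mem_finset.1 (Finset.mem_of_mem_erase h1)).1
  refine ⟨insert (p - (e : ℤ)) (F.erase q), ⟨?_, ?_, ?_⟩, ?_, ?_, ?_, ?_⟩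
  · intro x hx
    rcases Finset.mem_insert.1 hx with rfl | hx
    · exact hpN
    · exact h.le x (Finset.mem_of_mem_erase hx)
  · rw [hdown]
    ext y
    simp only [Set.mem_union, Set.mem_sdiff, Set.mem_singleton_iff, Set.mem_Iio, Finset.mem_coe,
      Finset.mem_insert, Finset.mem_erase, h.mem_finset]
    constructor
    · rintro (⟨h1, h2⟩ | h1)
      · rcases lt_or_ge y N with h3 | h3
        · exact Or.inl h3
        · exact Or.inr (Or.inr ⟨h2, h1, h3⟩)
      · exact Or.inr (Or.inl h1)
    · rintro (h1 | h1 | ⟨h1, h2, h3⟩)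
      · exact Or.inl ⟨hN h1, by omega⟩
      · exact Or.inr h1
      · exact Or.inl ⟨h2, h1⟩
  · rw [hdown]
    have old : ∀ x ∈ J, x ≠ q → x ∈ J \ {q} ∪ {p - (e : ℤ)} := fun x hx hne => Or.inl ⟨hx, hne⟩
    have new : p - (e : ℤ) ∈ J \ {q} ∪ {p - (e : ℤ)} := Or.inr rfl
    rintro y (⟨hy, hyq⟩ | rfl)
    · obtain ⟨y', hy', h1, h2⟩ := h.gap y hy
      by_cases hne : y' = q
      -- The removed bead was the chosen neighbour of `y`. If `q < p`, then `q + e ∉ J` leaves room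
      -- for `p - e` or `p` to replace it; if `q = p`, then `u` or `u + e` does.
      · subst hne
        rcases hqp.lt_or_eq with hlt | rfl
        · have hne : y ≠ y' + e := fun h3 => by
            rcases hqe with h4 | h4
            · omega
            · exact h4 (h3 ▸ hy)
          rcases le_or_gt y p with hyp | hyp
          · exact ⟨_, new, by omega, by omega⟩
          · exact ⟨p, old p hp hlt.ne', by omega, hyp⟩
        · rcases le_or_gt (y - e) u with hyu | hyu
          · exact ⟨u, old u hu hup.ne, hyu, by omega⟩
          · exact ⟨u + e, old _ (hfull u hu hpu hup) (by omega), by omega, by omega⟩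
      · exact ⟨y', old y' hy' hne, h1, h2⟩
    · exact ⟨u - e, old _ (hcore u hu hup) (by omega), by omega, by omega⟩
  · rw [Finset.card_insert_of_notMem hpF, Finset.card_erase_add_one hqF]
  · rw [Finset.sum_insert hpF, ← Finset.add_sum_erase F _ hqF]
    omega
  · rintro j ⟨hj, hmax⟩
    -- If the greatest bead were moved, it would be `p = q`, but `u + e` exceeds `p` and lies in
    -- `J`.
    have hpj := hmax hp
    have hqj : j ≠ q := by
      rintro rfl
      obtain rfl : j = p := by omega
      have := hmax (hfull u hu hpu hup)
      omega
    rw [hdown]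
    refine ⟨Or.inl ⟨hj, hqj⟩, ?_⟩
    rintro x (⟨hx, _⟩ | rfl)
    · exact hmax hx
    · omega
  · intro z hz
    rw [hdown]
    exact insertUpTo_slide he hN hp hpe hcore ⟨u, hu, hpu, hup⟩ hq hpq hqp hfull hz

/-! ### Termination, and the base as a result of insertions -/

/-- Each step replaces `q` by the smaller `p - e ≥ N`, so the total height above `N` decreases. -/
theorem IsBeadSet.exists_slidable_eq_empty {e : ℕ} (he : 0 < e) {N : ℤ} {F : Finset ℤ}
    {J : Set ℤ} (h : IsBeadSet e N F J) : ∃ n, slidable e ((_root_.down e)^[n] J) = ∅ := by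
  induction hs : ∑ x ∈ F, (x - N).toNat using Nat.strong_induction_on generalizing F J with
  | _ s ih =>
    rcases Set.eq_empty_or_nonempty (slidable e J) with hU | hU
    · exact ⟨0, hU⟩
    · obtain ⟨F', h', _, hlt, _⟩ := h.down he hU
      obtain ⟨n, hn⟩ := ih _ (hs ▸ hlt) h' rfl
      exact ⟨n + 1, hn⟩

theorem slidable_base {e : ℕ} (he : 0 < e) {N : ℤ} {F : Finset ℤ} {J : Set ℤ}
    (h : IsBeadSet e N F J) : slidable e (base e J) = ∅ :=
  Nat.sInf_mem (s := {n : ℕ | slidable e ((down e)^[n] J) = ∅}) (h.exists_slidable_eq_empty he)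

theorem base_eq_self {e : ℕ} {J : Set ℤ} (h : slidable e J = ∅) : base e J = J := by
  have : sInf {n : ℕ | slidable e ((down e)^[n] J) = ∅} = 0 := Nat.sInf_eq_zero.2 (Or.inl h)
  rw [base, this]
  rfl

theorem IsBeadSet.iterate_down {e : ℕ} (he : 0 < e) {N : ℤ} {F : Finset ℤ} {J : Set ℤ}
    (h : IsBeadSet e N F J) {j : ℤ} (hj : IsGreatest J j) (n : ℕ) :
    ∃ F', IsBeadSet e N F' ((_root_.down e)^[n] J) ∧ F'.card = F.card ∧
      IsGreatest ((_root_.down e)^[n] J) j ∧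
      insertUpTo e N ((_root_.down e)^[n] J) (j + 1) = insertUpTo e N J (j + 1) := by
  induction n with
  | zero => exact ⟨F, h, rfl, hj, rfl⟩
  | succ n ih =>
    obtain ⟨F', h', hc, hj', hins⟩ := ih
    rw [Function.iterate_succ_apply']
    rcases Set.eq_empty_or_nonempty (slidable e ((_root_.down e)^[n] J)) with hU | hU
    · rw [down_eq_self hU]
      exact ⟨F', h', hc, hj', hins⟩
    · obtain ⟨F'', h'', hc', _, hj'', hins'⟩ := h'.down he hU
      refine ⟨F'', h'', hc'.trans hc, hj'' j hj', ?_⟩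
      rw [← hins, hins' (j + 1) fun x hx => by have := hj'.2 hx; omega]

theorem IsBeadSet.base {e : ℕ} (he : 0 < e) {N : ℤ} {F : Finset ℤ} {J : Set ℤ}
    (h : IsBeadSet e N F J) {j : ℤ} (hj : IsGreatest J j) :
    ∃ F', IsBeadSet e N F' (base e J) ∧ F'.card = F.card ∧ IsGreatest (base e J) j :=
  let ⟨F', h1, h2, h3, _⟩ := h.iterate_down he hj _
  ⟨F', h1, h2, h3⟩

/-- The base is computed by insertion. -/
theorem base_eq_insertUpTo {e : ℕ} (he : 0 < e) {N : ℤ} {F : Finset ℤ} {J : Set ℤ}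
    (h : IsBeadSet e N F J) {j : ℤ} (hj : IsGreatest J j) :
    base e J = insertUpTo e N J (j + 1) := by
  have hs := slidable_base he h
  obtain ⟨F', h', _, hj', hins⟩ :=
    h.iterate_down he hj (sInf {n : ℕ | slidable e ((down e)^[n] J) = ∅})
  have hNj : N ≤ j + 1 := by
    by_contra hlt
    have := hj.2 (h.Iio_subset (show j + 1 < N by omega))
    omega
  rw [← hins, insertUpTo_eq_inter he h'.Iio_subset hNj]
  · rw [eq_comm]
    exact Set.inter_eq_left.2 fun x hx => Int.lt_add_one_of_le (hj'.2 hx)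
  · intro x hx _
    by_contra hxe
    exact (Set.eq_empty_iff_forall_notMem.1 hs) x ⟨hx, hxe⟩

/-- The base of a set with greatest bead `j` arises by insertion of `j` into the base of the set
of the other beads. -/
theorem base_union_singleton {e : ℕ} (he : 0 < e) {N : ℤ} {F G : Finset ℤ} {J K : Set ℤ}
    {j k : ℤ} (hJ : IsBeadSet e N F J) (hK : IsBeadSet e N G K) (hj : IsGreatest J j)
    (hk : IsGreatest K k) (hkj : k < j) (hJK : J = K ∪ {j}) :
    base e J = insertBead e j (base e K) := by
  have hNk : N ≤ k + 1 := by
    by_contra hlt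
    have := hk.2 (hK.Iio_subset (show k + 1 < N by omega))
    omega
  rw [base_eq_insertUpTo he hJ hj, base_eq_insertUpTo he hK hk,
    insertUpTo_succ_of_mem e (by omega) hj.1,
    insertUpTo_eq_of_disjoint (a := k + 1) hNk (by omega)]
  · congr 1
    refine insertUpTo_congr_below hNk fun y hy => ?_
    rw [hJK]
    simp only [Set.mem_union, Set.mem_singleton_iff, or_iff_left (show y ≠ j by omega)]
  · intro y h1 h2 hy
    rw [hJK] at hy
    rcases hy with hy | hy
    · have := hk.2 hy; omega
    · exact h2.ne hy

/-! ### Beta numbers and restricted partitions -/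

theorem betaNumber_succ_lt {m : ℤ} {l : ℕ → ℕ} (hl : IsPartition l) (k : ℕ) :
    betaNumber m l (k + 1) < betaNumber m l k := by
  have : l (k + 1) ≤ l k := hl.1 (Nat.le_succ k)
  simp only [betaNumber, Nat.cast_add, Nat.cast_one] at *
  omega

theorem betaNumber_strictAnti {m : ℤ} {l : ℕ → ℕ} (hl : IsPartition l) :
    StrictAnti (betaNumber m l) :=
  strictAnti_nat_of_succ_lt (betaNumber_succ_lt hl)

theorem betaNumber_le_add {e : ℕ} {m : ℤ} {l : ℕ → ℕ} (hr : IsRestricted e l) (k : ℕ) :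
    betaNumber m l k ≤ betaNumber m l (k + 1) + e := by
  have := hr k
  simp only [betaNumber, Nat.cast_add, Nat.cast_one]
  omega

theorem isGreatest_betaSet {m : ℤ} {l : ℕ → ℕ} (hl : IsPartition l) :
    IsGreatest (betaSet m l) (betaNumber m l 0) := by
  refine ⟨⟨0, rfl⟩, ?_⟩
  rintro _ ⟨k, rfl⟩
  exact (betaNumber_strictAnti hl).antitone (Nat.zero_le k)

/-- The set of beta numbers of the rows of `l` with index at least `k`. -/
def betaTail (m : ℤ) (l : ℕ → ℕ) (k : ℕ) : Set ℤ :=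
  betaSet (m - k) fun i => l (i + k)

theorem betaNumber_tail (m : ℤ) (l : ℕ → ℕ) (k i : ℕ) :
    betaNumber (m - k) (fun i => l (i + k)) i = betaNumber m l (i + k) := by
  simp only [betaNumber, Nat.cast_add]
  ring

theorem betaTail_eq_image (m : ℤ) (l : ℕ → ℕ) (k : ℕ) :
    betaTail m l k = betaNumber m l '' Set.Ici k := by
  ext y
  simp only [betaTail, betaSet, Set.mem_range, betaNumber_tail, Set.mem_image, Set.mem_Ici]
  constructor
  · rintro ⟨i, rfl⟩
    exact ⟨i + k, by omega, rfl⟩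
  · rintro ⟨i, hi, rfl⟩
    exact ⟨i - k, by rw [Nat.sub_add_cancel hi]⟩

theorem betaTail_zero (m : ℤ) (l : ℕ → ℕ) : betaTail m l 0 = betaSet m l := by
  simp [betaTail]

theorem betaTail_eq_union (m : ℤ) (l : ℕ → ℕ) (k : ℕ) :
    betaTail m l k = betaTail m l (k + 1) ∪ {betaNumber m l k} := by
  rw [betaTail_eq_image, betaTail_eq_image, ← Set.image_singleton, ← Set.image_union]
  congr 1
  ext i
  simp only [Set.mem_Ici, Set.mem_union, Set.mem_singleton_iff]
  omega

theorem betaSet_inter_Iic {m : ℤ} {l : ℕ → ℕ} (hl : IsPartition l) (k : ℕ) :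
    betaSet m l ∩ Set.Iic (betaNumber m l k - 1) = betaTail m l (k + 1) := by
  rw [betaTail_eq_image]
  ext y
  simp only [betaSet, Set.mem_inter_iff, Set.mem_range, Set.mem_Iic, Set.mem_image, Set.mem_Ici,
    Int.le_sub_one_iff]
  constructor
  · rintro ⟨⟨i, rfl⟩, h⟩
    exact ⟨i, (betaNumber_strictAnti hl).lt_iff_gt.1 h, rfl⟩
  · rintro ⟨i, hi, rfl⟩
    exact ⟨⟨i, rfl⟩, betaNumber_strictAnti hl hi⟩

theorem IsPartition.tail {l : ℕ → ℕ} (hl : IsPartition l) (k : ℕ) :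
    IsPartition fun i => l (i + k) := by
  refine ⟨fun i j h => hl.1 (Nat.add_le_add_right h k), ?_⟩
  refine (hl.2.preimage ((add_left_injective k).injOn (s := (fun i => i + k) ⁻¹' l.support))).subset
    fun i hi => hi

theorem isRestrictedBetaSet_betaTail {e : ℕ} (m : ℤ) {l : ℕ → ℕ} (hl : IsPartition l)
    (hr : IsRestricted e l) (k : ℕ) : IsRestrictedBetaSet e (m - k) (betaTail m l k) :=
  ⟨_, hl.tail k, fun i => by
    simpa only [add_right_comm] using hr (i + k), rfl⟩

theorem isGreatest_betaTail {m : ℤ} {l : ℕ → ℕ} (hl : IsPartition l) (k : ℕ) :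
    IsGreatest (betaTail m l k) (betaNumber m l k) := by
  have := isGreatest_betaSet (m := m - k) (hl.tail k)
  rwa [betaNumber_tail, zero_add] at this

/-- Adding a new greatest bead, at distance at most `e`, to a restricted set of beta numbers. -/
theorem IsRestrictedBetaSet.union_singleton {e : ℕ} {m j k : ℤ} {K : Set ℤ}
    (hK : IsRestrictedBetaSet e (m - 1) K) (hk : IsGreatest K k) (hkj : k < j) (hjk : j ≤ k + e) :
    IsRestrictedBetaSet e m (K ∪ {j}) := by
  obtain ⟨l, hl, hr, rfl⟩ := hK
  obtain rfl := hk.unique (isGreatest_betaSet hl)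
  simp only [betaNumber] at hkj hjk
  push_cast at hkj hjk
  -- The new first part is `j - m`, which is non-negative because `j` exceeds `l 0 + m - 1`.
  let l' : ℕ → ℕ := fun i => Nat.casesOn i (j - m).toNat l
  have h0 : ((j - m).toNat : ℤ) = j - m := Int.toNat_of_nonneg (by omega)
  have hl' : IsPartition l' := by
    refine ⟨antitone_nat_of_succ_le fun i => ?_, ?_⟩
    · cases i with
      | zero => change l 0 ≤ (j - m).toNat; omega
      | succ i => exact hl.1 (Nat.le_succ i)
    · refine ((hl.2.image Nat.succ).insert 0).subset fun i hi => ?_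
      cases i with
      | zero => exact Or.inl rfl
      | succ i => exact Or.inr ⟨i, hi, rfl⟩
  refine ⟨l', hl', fun i => ?_, ?_⟩
  · cases i with
    | zero => change (j - m).toNat < l 0 + e; omega
    | succ i => exact hr i
  · have hb : betaNumber m l' 0 = j := by
      change ((j - m).toNat : ℤ) + m - ((0 : ℕ) : ℤ) = j
      rw [h0]; push_cast; ring
    rw [← betaTail_zero, betaTail_eq_union, hb]
    congr 1

/-- A restricted set of beta numbers contains all small integers, and finitely many others. -/
theorem IsRestrictedBetaSet.exists_isBeadSet {e : ℕ} {m : ℤ} {J : Set ℤ}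
    (hJ : IsRestrictedBetaSet e m J) :
    ∃ M, ∀ N ≤ M, ∃ F, IsBeadSet e N F J ∧ N + (F.card : ℤ) = m + 1 := by
  obtain ⟨l, hl, hr, rfl⟩ := hJ
  obtain ⟨n, hn⟩ := hl.2.bddAbove
  have hzero : ∀ k, n < k → l k = 0 := by
    intro k hk
    by_contra h
    have := hn (show k ∈ Function.support l from h)
    omega
  -- Parts with index above `n` vanish, so all integers below `m - n` are beta numbers. For `N ≤ m -
  -- n`, those at least `N` are the first `m + 1 - N`.
  refine ⟨m - n, fun N hN => ⟨(Finset.range (m + 1 - N).toNat).image (betaNumber m l),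
    ⟨?_, ?_, ?_⟩, ?_⟩⟩
  · intro x hx
    obtain ⟨k, hk, rfl⟩ := Finset.mem_image.1 hx
    have := Finset.mem_range.1 hk
    simp only [betaNumber]
    omega
  · ext y
    simp only [betaSet, Set.mem_range, Set.mem_union, Set.mem_Iio, Finset.coe_image,
      Finset.coe_range, Set.mem_image]
    constructor
    · rintro ⟨k, rfl⟩
      rcases lt_or_ge k (m + 1 - N).toNat with hk | hk
      · exact Or.inr ⟨k, hk, rfl⟩
      · left
        rw [betaNumber, hzero k (by omega)]
        omega
    · rintro (hy | ⟨k, _, rfl⟩)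
      · refine ⟨(m - y).toNat, ?_⟩
        rw [betaNumber, hzero _ (by omega)]
        omega
      · exact ⟨k, rfl⟩
  · rintro _ ⟨k, rfl⟩
    have := betaNumber_le_add (m := m) hr k
    exact ⟨_, ⟨k + 1, rfl⟩, by omega, betaNumber_succ_lt hl k⟩
  · rw [Finset.card_image_of_injective _ (betaNumber_strictAnti hl).injective, Finset.card_range]
    omega

/-- The beads of `F` are the first rows of a partition, added in increasing order to the empty
partition of charge `N - 1`; each raises the charge by one, and the gap condition bounds the new
difference of parts. -/
theorem IsBeadSet.isRestrictedBetaSet {e : ℕ} (he : 0 < e) {N : ℤ} {F : Finset ℤ} :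
    ∀ {m : ℤ} {J : Set ℤ}, IsBeadSet e N F J → N + (F.card : ℤ) = m + 1 →
      IsRestrictedBetaSet e m J := by
  induction F using Finset.induction_on_max with
  | empty =>
    intro m J h hm
    refine ⟨fun _ => 0, ⟨antitone_const, ?_⟩, fun _ => by simpa using he, ?_⟩
    · simp [Function.support]
    · rw [h.eq]
      simp only [Finset.card_empty, Nat.cast_zero, add_zero] at hm
      ext y
      simp only [betaSet, betaNumber, Set.mem_range, Finset.coe_empty, Set.union_empty,
        Set.mem_Iio]
      constructor
      · rintro ⟨k, rfl⟩
        push_cast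
        omega
      · intro hy
        exact ⟨(m - y).toNat, by push_cast; omega⟩
  | insert a F ha ih =>
    intro m J h hm
    have haF : a ∉ F := fun h => (ha a h).ne rfl
    have haN := h.le a (Finset.mem_insert_self a F)
    have hJ : J = (Set.Iio N ∪ ↑F) ∪ {a} := by
      rw [h.eq, Finset.coe_insert, Set.insert_eq, Set.union_comm {a}, Set.union_assoc]
    have hlt : ∀ y ∈ Set.Iio N ∪ (↑F : Set ℤ), y < a := by
      rintro y (hy | hy)
      · exact lt_of_lt_of_le hy haN
      · exact ha y hy
    have hK : IsBeadSet e N F (Set.Iio N ∪ ↑F) := by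
      refine ⟨fun x hx => h.le x (Finset.mem_insert_of_mem hx), rfl, fun y hy => ?_⟩
      obtain ⟨y', hy', h1, h2⟩ := h.gap y (hJ ▸ Or.inl hy)
      rw [hJ] at hy'
      rcases hy' with hy' | rfl
      · exact ⟨y', hy', h1, h2⟩
      · have := hlt y hy; omega
    rw [Finset.card_insert_of_notMem haF] at hm
    have hK' := ih (m := m - 1) hK (by push_cast at hm; omega)
    obtain ⟨y, hy, h1, h2⟩ := h.gap a (hJ ▸ Or.inr rfl)
    rw [hJ] at hy ⊢
    have hy' : y ∈ Set.Iio N ∪ (↑F : Set ℤ) := by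
      rcases hy with hy | rfl
      · exact hy
      · omega
    obtain ⟨l, hl, _, hlK⟩ := id hK'
    have hg : IsGreatest (Set.Iio N ∪ (↑F : Set ℤ)) _ := hlK ▸ isGreatest_betaSet hl
    have := hg.2 hy'
    exact hK'.union_singleton hg (hlt _ hg.1) (by omega)

/-! ### Row by row computation of the base -/

theorem IsRestrictedBetaSet.slidable_base {e : ℕ} (he : 0 < e) {m : ℤ} {J : Set ℤ}
    (hJ : IsRestrictedBetaSet e m J) : slidable e (base e J) = ∅ := by
  obtain ⟨N, hN⟩ := hJ.exists_isBeadSet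
  obtain ⟨F, hF, _⟩ := hN N le_rfl
  exact _root_.slidable_base he hF

theorem IsRestrictedBetaSet.base {e : ℕ} (he : 0 < e) {m j : ℤ} {J : Set ℤ}
    (hJ : IsRestrictedBetaSet e m J) (hj : IsGreatest J j) :
    IsRestrictedBetaSet e m (base e J) ∧ IsGreatest (base e J) j := by
  obtain ⟨N, hN⟩ := hJ.exists_isBeadSet
  obtain ⟨F, hF, hc⟩ := hN N le_rfl
  obtain ⟨F', hF', hc', hj'⟩ := hF.base he hj
  exact ⟨hF'.isRestrictedBetaSet he (by rw [hc', hc]), hj'⟩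

theorem isGreatest_union_singleton {K : Set ℤ} {j k : ℤ} (hk : IsGreatest K k) (hkj : k < j) :
    IsGreatest (K ∪ {j}) j := by
  refine ⟨Or.inr rfl, ?_⟩
  rintro x (hx | rfl)
  · exact (hk.2 hx).trans hkj.le
  · exact le_rfl

theorem IsRestrictedBetaSet.base_union_singleton {e : ℕ} (he : 0 < e) {m j k : ℤ} {K : Set ℤ}
    (hK : IsRestrictedBetaSet e (m - 1) K) (hk : IsGreatest K k) (hkj : k < j) (hjk : j ≤ k + e) :
    _root_.base e (K ∪ {j}) = insertBead e j (_root_.base e K) := by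
  obtain ⟨M, hM⟩ := hK.exists_isBeadSet
  obtain ⟨M', hM'⟩ := (hK.union_singleton hk hkj hjk).exists_isBeadSet
  -- Both insertions must start from the same `N`.
  obtain ⟨F, hF, _⟩ := hM (min M M') (min_le_left _ _)
  obtain ⟨F', hF', _⟩ := hM' (min M M') (min_le_right _ _)
  exact _root_.base_union_singleton he hF' hF (isGreatest_union_singleton hk hkj) hk hkj rfl

/-- One row of the computation of the base. -/
theorem IsRestrictedBetaSet.base_base_union_singleton {e : ℕ} (he : 0 < e) {m j k : ℤ}
    {K : Set ℤ} (hK : IsRestrictedBetaSet e (m - 1) K) (hk : IsGreatest K k) (hkj : k < j)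
    (hjk : j ≤ k + e) :
    IsRestrictedBetaSet e m (_root_.base e K ∪ {j}) ∧
      _root_.base e (K ∪ {j}) = _root_.base e (_root_.base e K ∪ {j}) := by
  obtain ⟨hB, hb⟩ := hK.base he hk
  refine ⟨hB.union_singleton hb hkj hjk, ?_⟩
  rw [hK.base_union_singleton he hk hkj hjk, hB.base_union_singleton he hb hkj hjk,
    base_eq_self (hK.slidable_base he)]

/-- One row of the computation of the base of a restricted partition. -/
theorem base_betaTail {e : ℕ} (he : 0 < e) (m : ℤ) {l : ℕ → ℕ} (hl : IsPartition l)
    (hr : IsRestricted e l) (k : ℕ) :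
    IsRestrictedBetaSet e (m - k) (base e (betaTail m l (k + 1)) ∪ {betaNumber m l k}) ∧
      base e (betaTail m l k) = base e (base e (betaTail m l (k + 1)) ∪ {betaNumber m l k}) := by
  have h := isRestrictedBetaSet_betaTail m hl hr (k + 1)
  rw [Nat.cast_add, Nat.cast_one, ← sub_sub] at h
  rw [betaTail_eq_union m l k]
  exact h.base_base_union_singleton he (isGreatest_betaTail hl (k + 1)) (betaNumber_succ_lt hl k)
    (betaNumber_le_add hr k)

theorem mainTheorem8 (e : ℕ) (he : 2 ≤ e) (m : ℤ) (l : ℕ → ℕ)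
    (hl : IsPartition l) (hr : IsRestricted e l)
    (J : Set ℤ) (hJ : J = betaSet m l) (j₀ : ℤ) (hj₀ : IsGreatest J j₀)
    (K : Set ℤ) (hK : K = J ∩ Set.Iic (j₀ - 1)) :
    -- the down processes started at `J` and at `K` stop
    (slidable e (base e J) = ∅ ∧ slidable e (base e K) = ∅) ∧
    -- the extension of `base K` by `j₀` is `e`-restricted and has the same base as `J`
    IsRestrictedBetaSet e m (base e K ∪ {j₀}) ∧
    base e J = base e (base e K ∪ {j₀}) ∧
    -- row by row computation of `base J`, starting below the row with index `r`
    ∀ (r : ℕ) (S : ℕ → Set ℤ),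
      S (r + 1) = J ∩ Set.Iic (betaNumber m l r - 1) →
      (∀ k ≤ r, S k = base e (S (k + 1)) ∪ {betaNumber m l k}) →
      (∀ k ≤ r, IsRestrictedBetaSet e (m - (k : ℤ)) (S k)) ∧ base e J = base e (S 0) := by
  have he0 : 0 < e := by omega
  subst hJ
  obtain rfl := hj₀.unique (isGreatest_betaSet hl)
  rw [betaSet_inter_Iic hl 0] at hK
  subst hK
  have h0 := base_betaTail he0 m hl hr 0
  rw [betaTail_zero, Nat.cast_zero, sub_zero] at h0
  refine ⟨⟨IsRestrictedBetaSet.slidable_base he0 ⟨l, hl, hr, rfl⟩,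
    (isRestrictedBetaSet_betaTail m hl hr (0 + 1)).slidable_base he0⟩, h0.1, h0.2, ?_⟩
  intro r S hS1 hS
  rw [betaSet_inter_Iic hl r] at hS1
  -- `S k` need not be the tail of `J`; only their bases agree, which suffices because `S k` depends
  -- on `S (k + 1)` through its base alone.
  have key : ∀ k ≤ r + 1, base e (S k) = base e (betaTail m l k) := by
    intro k hk
    induction hk using Nat.decreasingInduction with
    | self => rw [hS1]
    | of_succ k hk ih => rw [hS k (by omega), ih, (base_betaTail he0 m hl hr k).2]
  refine ⟨fun k hk => ?_, ?_⟩
  · rw [hS k hk, key (k + 1) (by omega)]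
    exact (base_betaTail he0 m hl hr k).1
  · rw [key 0 (by omega), betaTail_zero]
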